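/- Let $n\ge 1$ and let $G$ be a multigraph (multiple edges allowed, no loops) with vertex set $\{0,1,\dots,n\}$ and root $0$, where $\omega_G(\{i,j\})\in\mathbb N=\{0,1,2,\dots\}$ denotes the number of edges between distinct vertices $i$ and $j$. A $G$-parking function is a sequence $(\alpha_1,\dots,\alpha_n)\in\mathbb N^n$ such that every nonempty $U\subseteq\{1,\dots,n\}$ contains some $i$ with $\alpha_i\le \big(\sum_{j\in\{0,\dots,n\}\setminus U}\omega_G(\{i,j\})\big)-1$; the set of these is $\mathrm{PF}(G)$. For $\mathbf x=(x_1,\dots,x_n)\in\mathbb N^n$, $\mathrm{PF}(\mathbf x)$ is the set of $\alpha\in\mathbb N^n$ whose weakly increasing rearrangement $\alpha_{i_1}\le\dots\le\alpha_{i_n}$ satisfies $\alpha_{i_j}\le x_1+\dots+x_j-1$ for all $1\le j\le n$. The symmetric group $\mathfrak S_n$ acts on $\mathbb N^n$ by permuting coordinates. A tree is a connected multigraph with one edge fewer than vertices (counted with multiplicity); a cycle is a connected multigraph in which every vertex has degree $2$. For $a\ge1$, $G$ is an $a$-tree (resp. $a$-cycle) if $\omega_G=a\cdot\omega_H$ for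 some tree (resp. cycle) $H$ on the vertex set of $G$. For $a,b\ge1$, $K^{a,b}_{n+1}$ is the multigraph on $\{0,\dots,n\}$ with $\omega(\{0,i\})=a$ for $1\le i\le n$ and $\omega(\{i,j\})=b$ for $1\le i<j\le n$. **Theorem.** (i) Suppose that $G$ is connected and that $\mathrm{PF}(G)$ is invariant under $\mathfrak S_n$. Then at least one of the following holds: 1. for some $a\ge1$, $G$ is an $a$-tree and $\mathrm{PF}(G)=\mathrm{PF}\big((a,\underbrace{0,\dots,0}_{n-1})\big)$; 2. $n\ge2$ and, for some $a\ge1$, $G$ is an $a$-cycle and $\mathrm{PF}(G)=\mathrm{PF}\big((a,\underbrace{0,\dots,0}_{n-2},a)\big)$; 3. for some $a,b\ge1$, $G=K^{a,b}_{n+1}$ and $\mathrm{PF}(G)=\mathrm{PF}\big((a,\underbrace{b,\dots,b}_{n-1})\big)$. If $n\ge 2$, case 1 excludes cases 2 and 3; if $n\ge3$, cases 2 and 3 also exclude each other, so exactly one of the three cases holds. (ii) If $\mathrm{PF}(G)$ (for $G$ connected or not) is not invariant under $\mathfrak S_n$, then $\mathrm{PF}(G)\ne\mathrm{PF}(\mathbf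 x)$ for every $\mathbf x\in\mathbb N^n$. -/

import Mathlib

/-- A finite multigraph without loops on the vertex set `{0, 1, …, n}`, rooted at `0`, given by its
edge-weight function: `weight i j` is the number of edges between `i` and `j`. The value on the
diagonal carries no information and is fixed to be `0`. -/
@[ext]
structure Multigraph (n : ℕ) where
  weight : Fin (n + 1) → Fin (n + 1) → ℕ
  symm : ∀ i j, weight i j = weight j i
  loopless : ∀ i, weight i i = 0

namespace Multigraph

variable {n : ℕ}

/-- A set of non-root vertices, seen inside `{0, 1, …, n}`: the element `i : Fin n` stands for the
non-root vertex `i.succ`. -/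
def nonrootSet (U : Finset (Fin n)) : Finset (Fin (n + 1)) :=
  U.map (Fin.succEmb n)

/-- The number of edges from the vertex `i` to vertices outside `U`. -/
def degOut (G : Multigraph n) (U : Finset (Fin (n + 1))) (i : Fin (n + 1)) : ℕ :=
  ∑ j ∈ Uᶜ, G.weight i j

/-- The degree of a vertex. -/
def degree (G : Multigraph n) (i : Fin (n + 1)) : ℕ :=
  G.degOut {i} i

/-- The number of edges, with multiplicity. -/
def numEdges (G : Multigraph n) : ℕ :=
  ∑ i, ∑ j ∈ Finset.Ioi i, G.weight i j

/-- Every nonempty set of non-root vertices has an edge leaving it. -/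
def Connected (G : Multigraph n) : Prop :=
  ∀ U : Finset (Fin n), U.Nonempty → ∃ i ∈ U, 1 ≤ G.degOut (nonrootSet U) i.succ

/-- A tree: a connected multigraph with one edge fewer than vertices. -/
def IsTree (G : Multigraph n) : Prop :=
  G.Connected ∧ G.numEdges = n

/-- A cycle: a connected multigraph all of whose vertices have degree two. -/
def IsCycle (G : Multigraph n) : Prop :=
  G.Connected ∧ ∀ i, G.degree i = 2

/-- An `a`-tree: a tree with all weights multiplied by `a ≥ 1`. -/
def IsMulTree (G : Multigraph n) (a : ℕ) : Prop :=
  1 ≤ a ∧ ∃ T : Multigraph n, T.IsTree ∧ ∀ i j, G.weight i j = a * T.weight i j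

/-- An `a`-cycle: a cycle with all weights multiplied by `a ≥ 1`. -/
def IsMulCycle (G : Multigraph n) (a : ℕ) : Prop :=
  1 ≤ a ∧ ∃ C : Multigraph n, C.IsCycle ∧ ∀ i j, G.weight i j = a * C.weight i j

/-- The multigraph on `{0, 1, …, n}` in which `0` is joined to every other vertex by `a` edges and
any two distinct non-root vertices are joined by `b` edges. -/
def completeMul (n a b : ℕ) : Multigraph n where
  weight i j := if i = j then 0 else if i = 0 ∨ j = 0 then a else b
  symm i j := by simp only [eq_comm (a := i) (b := j), or_comm (a := i = 0)]
  loopless i := by simp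

/-- The set of `G`-parking functions; the entry `α i` with `i : Fin n` belongs to the non-root
vertex `i.succ`. The inequality `α i < d` is `α i ≤ d - 1` in the integers. -/
def parkingFunctions (G : Multigraph n) : Set (Fin n → ℕ) :=
  {α | ∀ U : Finset (Fin n), U.Nonempty → ∃ i ∈ U, α i < G.degOut (nonrootSet U) i.succ}

end Multigraph

/-- The set of `x`-parking functions: the sequences whose weakly increasing rearrangement has its
`j`-th entry less than `x₁ + ⋯ + x_j` for every `j`. -/
def vectorParkingFunctions {n : ℕ} (x : Fin n → ℕ) : Set (Fin n → ℕ) :=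
  {α | ∃ τ : Equiv.Perm (Fin n), Monotone (α ∘ τ) ∧ ∀ j, α (τ j) < ∑ i ∈ Finset.Iic j, x i}

/-- Invariance of a set of sequences under the action of the symmetric group by
`(σ α) i = α (σ⁻¹ i)`. -/
def PermInvariant {n : ℕ} (S : Set (Fin n → ℕ)) : Prop :=
  ∀ σ : Equiv.Perm (Fin n), ∀ α ∈ S, (fun i => α (σ⁻¹ i)) ∈ S

/-- The vector `(a, b, b, …, b)` of length `n`. -/
def headVec (n a b : ℕ) : Fin n → ℕ :=
  fun i => if (i : ℕ) = 0 then a else b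

/-- The vector `(a, 0, …, 0, a)` of length `n`, for `n ≥ 2`. -/
def endsVec (n a : ℕ) : Fin n → ℕ :=
  fun i => if (i : ℕ) = 0 ∨ (i : ℕ) + 1 = n then a else 0

namespace Multigraph

variable {n : ℕ}

/-- `G` is an `a`-tree and its parking functions are those of `(a, 0, …, 0)`, for some `a ≥ 1`. -/
def TreeCase (G : Multigraph n) : Prop :=
  ∃ a : ℕ, 1 ≤ a ∧ G.IsMulTree a ∧
    G.parkingFunctions = vectorParkingFunctions (headVec n a 0)

/-- `G` is an `a`-cycle and its parking functions are those of `(a, 0, …, 0, a)`, for some `a ≥ 1`;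
the vector has two ends, so `n ≥ 2`. -/
def CycleCase (G : Multigraph n) : Prop :=
  2 ≤ n ∧ ∃ a : ℕ, 1 ≤ a ∧ G.IsMulCycle a ∧
    G.parkingFunctions = vectorParkingFunctions (endsVec n a)

/-- `G` is the weighted complete graph with parameters `a, b ≥ 1` and its parking functions are
those of `(a, b, …, b)`. -/
def CompleteCase (G : Multigraph n) : Prop :=
  ∃ a b : ℕ, 1 ≤ a ∧ 1 ≤ b ∧ G = completeMul n a b ∧
    G.parkingFunctions = vectorParkingFunctions (headVec n a b)

end Multigraph

/-! Everything is read off from parking functions with at most two nonzero entries. The attachment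
number `attach S i` counts the edges from `i` to the root component of G − S. It bounds a single
nonzero entry, and `twoPoint_mem_iff` uses it to decide two nonzero entries. Invariance makes all
`attach {x} x` equal to some c, and leaves two alternatives for pairs (`attach_dichotomy`).

If in each pair one vertex keeps all c attachments when the other is removed, then every vertex has
exactly one neighbour reachable without it, its parent. All edges go to parents with multiplicity c,
so G is a c-tree.

Otherwise every pair has `attach {x, y} x = A` with 0 < A < c. Put b = c − A. No non-root vertex is
a cut vertex, so every non-root degree is A + b, and w(x,y) plus the weight from x to the vertices
separated from the root by {x, y} equals b (`weight_add_sum`). If no pair separates anything, G is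
complete with weights a, b. If some pair does, induction on the separated set gives A = b, all
weights lie in {0, b}, and all degrees are 2b, so G is a b-cycle.

Part (ii) holds because the set of x-parking functions is always invariant. -/

namespace Multigraph

variable {n : ℕ}

/-! ### Root components and attachment numbers -/

/-- The vertices that can be reached from the root along edges avoiding the vertices of `S`. -/
noncomputable def rootComponent (G : Multigraph n) (S : Finset (Fin (n + 1))) :
    Finset (Fin (n + 1)) := by
  classical
  exact Finset.univ.filter (Relation.ReflTransGen (fun u v => 0 < G.weight u v ∧ v ∉ S) 0)

/-- The number of edges from `i` to the vertices reachable from the root in `G - S`. -/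
noncomputable def attach (G : Multigraph n) (S : Finset (Fin (n + 1))) (i : Fin (n + 1)) : ℕ :=
  ∑ j ∈ G.rootComponent S, G.weight i j

theorem zero_mem_rootComponent (G : Multigraph n) (S : Finset (Fin (n + 1))) :
    0 ∈ G.rootComponent S := by
  simp [rootComponent, Relation.ReflTransGen.refl]

theorem mem_rootComponent_of_weight_pos {G : Multigraph n} {S : Finset (Fin (n + 1))}
    {u v : Fin (n + 1)} (hu : u ∈ G.rootComponent S) (huv : 0 < G.weight u v) (hv : v ∉ S) :
    v ∈ G.rootComponent S := by
  simp only [rootComponent, Finset.mem_filter, Finset.mem_univ, true_and] at hu ⊢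
  exact hu.tail ⟨huv, hv⟩

theorem rootComponent_induction {G : Multigraph n} {S : Finset (Fin (n + 1))}
    {P : Fin (n + 1) → Prop} (h0 : P 0)
    (hstep : ∀ u v, u ∈ G.rootComponent S → P u → 0 < G.weight u v → v ∉ S → P v)
    {v : Fin (n + 1)} (hv : v ∈ G.rootComponent S) : P v := by
  have hv' := hv
  simp only [rootComponent, Finset.mem_filter, Finset.mem_univ, true_and] at hv'
  induction hv' with
  | refl => exact h0
  | @tail b c hb hbc ih =>
    have hb' : b ∈ G.rootComponent S := by
      simpa only [rootComponent, Finset.mem_filter, Finset.mem_univ, true_and] using hb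
    exact hstep b c hb' (ih hb') hbc.1 hbc.2

theorem not_mem_of_mem_rootComponent {G : Multigraph n} {S : Finset (Fin (n + 1))}
    (hS : 0 ∉ S) {v : Fin (n + 1)} (hv : v ∈ G.rootComponent S) : v ∉ S :=
  rootComponent_induction (P := fun v => v ∉ S) hS (fun _ _ _ _ _ h => h) hv

theorem rootComponent_anti (G : Multigraph n) {S T : Finset (Fin (n + 1))} (h : S ⊆ T) :
    G.rootComponent T ⊆ G.rootComponent S := fun _ hv =>
  rootComponent_induction (P := fun v => v ∈ G.rootComponent S) (zero_mem_rootComponent _ _)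
    (fun _ _ _ hu huv hv => mem_rootComponent_of_weight_pos hu huv fun h' => hv (h h')) hv

theorem attach_anti (G : Multigraph n) {S T : Finset (Fin (n + 1))} (h : S ⊆ T)
    (i : Fin (n + 1)) : G.attach T i ≤ G.attach S i :=
  Finset.sum_le_sum_of_subset (G.rootComponent_anti h)

theorem exists_of_attach_pos {G : Multigraph n} {S : Finset (Fin (n + 1))} {i : Fin (n + 1)}
    (h : 0 < G.attach S i) : ∃ u ∈ G.rootComponent S, 0 < G.weight u i := by
  obtain ⟨u, hu, h⟩ := Finset.exists_ne_zero_of_sum_ne_zero h.ne'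
  exact ⟨u, hu, by rw [G.symm]; omega⟩

theorem succ_mem_nonrootSet {U : Finset (Fin n)} {i : Fin n} :
    i.succ ∈ nonrootSet U ↔ i ∈ U := by
  simp [nonrootSet]

theorem zero_not_mem_nonrootSet (U : Finset (Fin n)) : 0 ∉ nonrootSet U := by
  simp [nonrootSet, Fin.succ_ne_zero]

/-- The complement of a set containing the root comes from a set of non-root vertices. -/
theorem exists_nonrootSet_compl_eq {X : Finset (Fin (n + 1))} (h0 : 0 ∈ X) :
    ∃ U : Finset (Fin n), (nonrootSet U)ᶜ = X := by
  refine ⟨Finset.univ.filter fun i => i.succ ∉ X, ?_⟩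
  ext v
  refine Fin.cases ?_ (fun i => ?_) v
  · simp [zero_not_mem_nonrootSet, h0]
  · simp [succ_mem_nonrootSet]

/-- Passing to complements makes the test sets contain the root, so that they can be compared with
root components. -/
theorem mem_parkingFunctions_iff {G : Multigraph n} {α : Fin n → ℕ} :
    α ∈ G.parkingFunctions ↔ ∀ X : Finset (Fin (n + 1)), 0 ∈ X → (∃ v, v ∉ X) →
      ∃ i : Fin n, i.succ ∉ X ∧ α i < ∑ j ∈ X, G.weight i.succ j := by
  constructor
  · intro h X h0 ⟨v, hv⟩
    obtain ⟨U, rfl⟩ := exists_nonrootSet_compl_eq h0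
    obtain ⟨i, rfl⟩ := Fin.exists_succ_eq.2 (fun h : v = 0 => hv (h ▸ h0))
    obtain ⟨i, hi, h⟩ := h U ⟨i, by simpa [succ_mem_nonrootSet] using hv⟩
    exact ⟨i, by simpa [succ_mem_nonrootSet] using hi, h⟩
  · intro h U ⟨i, hi⟩
    obtain ⟨i, hi, h⟩ := h (nonrootSet U)ᶜ (by simp [zero_not_mem_nonrootSet])
      ⟨i.succ, by simpa [succ_mem_nonrootSet] using hi⟩
    exact ⟨i, by simpa [succ_mem_nonrootSet] using hi, h⟩

theorem connected_iff_zero_mem {G : Multigraph n} :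
    G.Connected ↔ (fun _ => 0) ∈ G.parkingFunctions := Iff.rfl

theorem connected_iff {G : Multigraph n} :
    G.Connected ↔ ∀ X : Finset (Fin (n + 1)), 0 ∈ X → (∃ v, v ∉ X) →
      ∃ u ∈ X, ∃ v, v ∉ X ∧ 0 < G.weight u v := by
  rw [connected_iff_zero_mem, mem_parkingFunctions_iff]
  refine forall_congr' fun X => forall_congr' fun h0 => forall_congr' fun _ => ⟨?_, ?_⟩
  · rintro ⟨i, hi, h⟩
    obtain ⟨u, hu, h⟩ := Finset.exists_ne_zero_of_sum_ne_zero h.ne'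
    exact ⟨u, hu, _, hi, by rw [G.symm]; omega⟩
  · rintro ⟨u, hu, v, hv, h⟩
    obtain ⟨i, rfl⟩ := Fin.exists_succ_eq.2 (fun h : v = 0 => hv (h ▸ h0))
    refine ⟨i, hv, lt_of_lt_of_le (G.symm _ _ ▸ h) ?_⟩
    exact Finset.single_le_sum (f := fun j => G.weight i.succ j) (fun _ _ => Nat.zero_le _) hu

/-- A sequence dominating the attachment numbers of a nonempty set is not a parking function. -/
theorem exists_lt_attach {G : Multigraph n} {α : Fin n → ℕ} (hα : α ∈ G.parkingFunctions)
    {S : Finset (Fin (n + 1))} (hS : 0 ∉ S) (hne : S.Nonempty) :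
    ∃ i : Fin n, i.succ ∈ S ∧ α i < G.attach S i.succ := by
  obtain ⟨v, hv⟩ := hne
  -- Test on the root component of G − S: a vertex outside it but adjacent to it must belong to S.
  obtain ⟨i, hi, h⟩ := mem_parkingFunctions_iff.1 hα _ (G.zero_mem_rootComponent S)
    ⟨v, fun h => not_mem_of_mem_rootComponent hS h hv⟩
  refine ⟨i, by_contra fun hiS => ?_, h⟩
  obtain ⟨u, hu, hui⟩ := exists_of_attach_pos (pos_of_gt h)
  exact hi (mem_rootComponent_of_weight_pos hu hui hiS)

theorem Connected.rootComponent_empty {G : Multigraph n} (hG : G.Connected)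
    (v : Fin (n + 1)) : v ∈ G.rootComponent ∅ := by
  by_contra hv
  obtain ⟨u, hu, v, hv, h⟩ := connected_iff.1 hG _ (G.zero_mem_rootComponent ∅) ⟨v, hv⟩
  exact hv (mem_rootComponent_of_weight_pos hu h (by simp))

/-- If `α` is not blocked outside `X`, then `X` contains the root component of `G - S` as soon as
the support of `α` outside `X` is contained in `S`. -/
theorem rootComponent_subset {G : Multigraph n} {α : Fin n → ℕ} {S X : Finset (Fin (n + 1))}
    (h0 : 0 ∈ X) (hX : ∀ i : Fin n, i.succ ∉ X → ∑ j ∈ X, G.weight i.succ j ≤ α i)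
    (hS : ∀ i : Fin n, i.succ ∉ X → i.succ ∉ S → α i = 0) : G.rootComponent S ⊆ X := by
  intro v hv
  refine rootComponent_induction (P := fun v => v ∈ X) h0 (fun u v _ hu huv hv => ?_) hv
  by_contra hvX
  obtain ⟨i, rfl⟩ := Fin.exists_succ_eq.2 (fun h : v = 0 => hvX (h ▸ h0))
  have h1 := hX i hvX
  rw [hS i hvX hv] at h1
  have h2 := Finset.single_le_sum (f := fun j => G.weight i.succ j) (fun _ _ => Nat.zero_le _) hu
  rw [G.symm] at huv
  omega

/-! ### Parking functions with at most two nonzero entries -/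

/-- A set X on which the parking condition fails contains the root component of G − {i, j}, hence
`i`; then that of G − {j}, hence `j`; then everything, by connectedness. The case `i = j` is allowed
and gives the one-point criterion. -/
theorem two_point_mem_of_lt {G : Multigraph n} (hG : G.Connected) {i j : Fin n}
    {α : Fin n → ℕ} (hα : ∀ k, k ≠ i → k ≠ j → α k = 0)
    (hi : α i < G.attach {i.succ, j.succ} i.succ) (hj : α j < G.attach {j.succ} j.succ) :
    α ∈ G.parkingFunctions := by
  rw [mem_parkingFunctions_iff]
  intro X h0 ⟨v, hv⟩
  by_contra! hX
  have h1 : i.succ ∈ X := by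
    by_contra hiX
    have hs := rootComponent_subset (S := {i.succ, j.succ}) h0 hX fun k _ hk => by
      simp only [Finset.mem_insert, Finset.mem_singleton, Fin.succ_inj, not_or] at hk
      exact hα k hk.1 hk.2
    have := hX i hiX
    have h3 : G.attach {i.succ, j.succ} i.succ ≤ ∑ j ∈ X, G.weight i.succ j :=
      Finset.sum_le_sum_of_subset hs
    omega
  have h2 : j.succ ∈ X := by
    by_contra hiX
    have hs := rootComponent_subset (S := {j.succ}) h0 hX fun k hkX hk => by
      simp only [Finset.mem_singleton, Fin.succ_inj] at hk
      exact hα k (fun h => hkX (h ▸ h1)) hk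
    have := hX j hiX
    have h3 : G.attach {j.succ} j.succ ≤ ∑ l ∈ X, G.weight j.succ l :=
      Finset.sum_le_sum_of_subset hs
    omega
  refine hv (rootComponent_subset (S := ∅) h0 hX (fun k hkX _ => ?_) (hG.rootComponent_empty v))
  exact hα k (fun h => hkX (h ▸ h1)) (fun h => hkX (h ▸ h2))

/-- The sequence with entries `p` at `i`, `q` at `j` and `0` elsewhere. -/
def twoPoint (i j : Fin n) (p q : ℕ) : Fin n → ℕ :=
  fun k => if k = i then p else if k = j then q else 0

/-- The two alternatives record which of `i`, `j` is absorbed first, while the other is still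
missing. Necessity comes from testing {i}, {j} and {i, j}. -/
theorem twoPoint_mem_iff {G : Multigraph n} (hG : G.Connected) {i j : Fin n} (hij : i ≠ j)
    (p q : ℕ) : twoPoint i j p q ∈ G.parkingFunctions ↔
      (p < G.attach {i.succ, j.succ} i.succ ∧ q < G.attach {j.succ} j.succ) ∨
      (p < G.attach {i.succ} i.succ ∧ q < G.attach {j.succ, i.succ} j.succ) := by
  have ei : twoPoint i j p q i = p := by simp [twoPoint]
  have ej : twoPoint i j p q j = q := by simp [twoPoint, hij.symm]
  have e0 : ∀ k, k ≠ i → k ≠ j → twoPoint i j p q k = 0 := fun k h h' => by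
    simp [twoPoint, h, h']
  constructor
  · intro h
    obtain ⟨k, hk, h1⟩ := exists_lt_attach h (S := {i.succ}) (by simp [(Fin.succ_ne_zero _).symm])
      (by simp)
    obtain ⟨k', hk', h2⟩ := exists_lt_attach h (S := {j.succ})
      (by simp [(Fin.succ_ne_zero _).symm]) (by simp)
    obtain ⟨l, hl, h3⟩ := exists_lt_attach h (S := {i.succ, j.succ})
      (by simp [(Fin.succ_ne_zero _).symm]) (by simp)
    simp only [Finset.mem_insert, Finset.mem_singleton, Fin.succ_inj] at hk hk' hl
    subst hk hk'
    rw [ei] at h1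
    rw [ej] at h2
    rcases hl with rfl | rfl
    · rw [ei] at h3
      exact Or.inl ⟨h3, h2⟩
    · rw [ej, Finset.pair_comm] at h3
      exact Or.inr ⟨h1, h3⟩
  · rintro (⟨h1, h2⟩ | ⟨h1, h2⟩)
    · exact two_point_mem_of_lt hG e0 (by rwa [ei]) (by rwa [ej])
    · exact two_point_mem_of_lt hG (fun k h h' => e0 k h' h) (by rwa [ej]) (by rwa [ei])

theorem lt_attach_of_mem {G : Multigraph n} {α : Fin n → ℕ} (hα : α ∈ G.parkingFunctions)
    (i : Fin n) : α i < G.attach {i.succ} i.succ := by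
  obtain ⟨k, hk, h⟩ := exists_lt_attach hα (S := {i.succ}) (by simp [(Fin.succ_ne_zero _).symm])
    (by simp)
  simp only [Finset.mem_singleton, Fin.succ_inj] at hk
  exact hk ▸ h

theorem single_mem_iff {G : Multigraph n} (hG : G.Connected) (i : Fin n) (p : ℕ) :
    Pi.single i p ∈ G.parkingFunctions ↔ p < G.attach {i.succ} i.succ := by
  refine ⟨fun h => by simpa using lt_attach_of_mem h i, fun h => ?_⟩
  refine two_point_mem_of_lt hG (i := i) (j := i) (fun k hk _ => by simp [hk]) ?_ ?_ <;> simpa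

/-- The symmetric group is transitive on ordered pairs of distinct indices. -/
theorem twoPoint_mem_congr {G : Multigraph n} (h : PermInvariant G.parkingFunctions)
    {i j k l : Fin n} (hij : i ≠ j) (hkl : k ≠ l) {p q : ℕ}
    (hm : twoPoint i j p q ∈ G.parkingFunctions) : twoPoint k l p q ∈ G.parkingFunctions := by
  obtain ⟨σ, h1, h2⟩ : ∃ σ : Equiv.Perm (Fin n), σ k = i ∧ σ l = j := by
    refine ⟨(Equiv.swap k i).trans (Equiv.swap (Equiv.swap k i l) j), ?_, ?_⟩
    · simp only [Equiv.trans_apply, Equiv.swap_apply_left]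
      refine Equiv.swap_apply_of_ne_of_ne (fun h => hkl ?_) hij
      rw [eq_comm, Equiv.swap_apply_eq_iff, Equiv.swap_apply_right] at h
      exact h.symm
    · simp
  have := h σ⁻¹ _ hm
  convert this using 1
  funext m
  simp only [twoPoint, inv_inv, ← h1, ← h2, σ.injective.eq_iff]

theorem attach_singleton_congr {G : Multigraph n} (hG : G.Connected)
    (h : PermInvariant G.parkingFunctions) (i j : Fin n) :
    G.attach {i.succ} i.succ = G.attach {j.succ} j.succ := by
  have key : ∀ i j : Fin n, ∀ p, p < G.attach {i.succ} i.succ → p < G.attach {j.succ} j.succ := by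
    intro i j p hp
    rw [← single_mem_iff hG] at hp ⊢
    have := h (Equiv.swap i j) _ hp
    convert this using 1
    funext m
    simp only [Pi.single_apply, Equiv.swap_inv, Equiv.swap_apply_eq_iff, Equiv.swap_apply_left]
  exact le_antisymm (Nat.le_of_not_lt fun hlt => (key i j _ hlt).false)
    (Nat.le_of_not_lt fun hlt => (key j i _ hlt).false)

theorem attach_le_attach_singleton (G : Multigraph n) (x y : Fin (n + 1)) :
    G.attach {x, y} x ≤ G.attach {x} x := G.attach_anti (by simp) x

/-- The dichotomy for the attachment numbers of pairs of vertices. -/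
theorem attach_dichotomy {G : Multigraph n} (hn : 1 ≤ n) (hG : G.Connected)
    (h : PermInvariant G.parkingFunctions) :
    ∃ c, 0 < c ∧ (∀ x ≠ 0, G.attach {x} x = c) ∧
      ((∀ x ≠ 0, ∀ y ≠ 0, x ≠ y → G.attach {x, y} x = c ∨ G.attach {y, x} y = c) ∨
      2 ≤ n ∧ ∃ A, 0 < A ∧ A < c ∧ ∀ x ≠ 0, ∀ y ≠ 0, x ≠ y → G.attach {x, y} x = A) := by
  have hc : ∀ x ≠ 0, G.attach {x} x = G.attach {(⟨0, hn⟩ : Fin n).succ} (⟨0, hn⟩ : Fin n).succ := by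
    intro x hx
    obtain ⟨i, rfl⟩ := Fin.exists_succ_eq.2 hx
    exact attach_singleton_congr hG h _ _
  have hpos := lt_attach_of_mem (connected_iff_zero_mem.1 hG) ⟨0, hn⟩
  generalize G.attach {(⟨0, hn⟩ : Fin n).succ} (⟨0, hn⟩ : Fin n).succ = c at hc hpos
  refine ⟨c, hpos, hc, ?_⟩
  by_cases hS : ∀ x ≠ 0, ∀ y ≠ 0, x ≠ y → G.attach {x, y} x = c ∨ G.attach {y, x} y = c
  · exact Or.inl hS
  push Not at hS
  obtain ⟨x, hx, y, hy, hxy, h1, h2⟩ := hS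
  obtain ⟨i, rfl⟩ := Fin.exists_succ_eq.2 hx
  obtain ⟨j, rfl⟩ := Fin.exists_succ_eq.2 hy
  have hij : i ≠ j := fun h => hxy (h ▸ rfl)
  have hle : ∀ k l : Fin n, G.attach {k.succ, l.succ} k.succ ≤ c := fun k l =>
    (attach_le_attach_singleton _ _ _).trans (hc _ (Fin.succ_ne_zero _)).le
  have hmem : ∀ k l : Fin n, k ≠ l → ∀ p q, twoPoint k l p q ∈ G.parkingFunctions ↔
      (p < G.attach {k.succ, l.succ} k.succ ∧ q < c) ∨
      (p < c ∧ q < G.attach {l.succ, k.succ} l.succ) := by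
    intro k l hkl p q
    rw [twoPoint_mem_iff hG hkl, hc _ (Fin.succ_ne_zero _), hc _ (Fin.succ_ne_zero _)]
  -- The test entries (c − 1, c − 1) park exactly when one of the two pair attachments is c. This
  -- fails at (i, j), hence at every pair.
  have hlt : ∀ k l : Fin n, k ≠ l → G.attach {k.succ, l.succ} k.succ < c := by
    intro k l hkl
    refine lt_of_le_of_ne (hle k l) fun he => ?_
    have := twoPoint_mem_congr h hkl hij ((hmem k l hkl (c - 1) (c - 1)).2 (Or.inl (by omega)))
    rw [hmem i j hij] at this
    have := hle i j
    have := hle j i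
    omega
  -- The test entries are the attachment number of k' and c − 1. If they parked at (k, l) they would
  -- park at (k', l'), where both alternatives fail.
  have hconst : ∀ k l k' l' : Fin n, k ≠ l → k' ≠ l' →
      G.attach {k.succ, l.succ} k.succ ≤ G.attach {k'.succ, l'.succ} k'.succ := by
    intro k l k' l' hkl hkl'
    refine Nat.le_of_not_lt fun hh => ?_
    have := twoPoint_mem_congr h hkl hkl'
      ((hmem k l hkl (G.attach {k'.succ, l'.succ} k'.succ) (c - 1)).2 (Or.inl ⟨hh, by omega⟩))
    rw [hmem k' l' hkl'] at this
    have := hlt k' l' hkl'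
    have := hlt l' k' hkl'.symm
    omega
  refine Or.inr ⟨?_, G.attach {i.succ, j.succ} i.succ, ?_, hlt i j hij, ?_⟩
  · by_contra hn'
    exact hij (Fin.ext (by omega))
  · have h0 := (hmem i j hij 0 0).1 (by
      convert connected_iff_zero_mem.1 hG using 1
      funext m
      simp [twoPoint])
    have := hconst j i i j hij.symm hij
    omega
  · intro x hx y hy hxy
    obtain ⟨k, rfl⟩ := Fin.exists_succ_eq.2 hx
    obtain ⟨l, rfl⟩ := Fin.exists_succ_eq.2 hy
    have hkl : k ≠ l := fun h => hxy (h ▸ rfl)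
    exact le_antisymm (hconst _ _ _ _ hkl hij) (hconst _ _ _ _ hij hkl)

/-! ### The tree alternative -/

/-- The multigraph with the same adjacency as `G` and all multiplicities at most one. -/
def support (G : Multigraph n) : Multigraph n where
  weight i j := if 0 < G.weight i j then 1 else 0
  symm i j := by rw [G.symm]
  loopless i := by simp [G.loopless]

theorem Connected.support {G : Multigraph n} (hG : G.Connected) : G.support.Connected := by
  rw [connected_iff] at hG ⊢
  intro X h0 hX
  obtain ⟨u, hu, v, hv, h⟩ := hG X h0 hX
  exact ⟨u, hu, v, hv, by simp [Multigraph.support, h]⟩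

theorem weight_eq_mul_support {G : Multigraph n} {a : ℕ}
    (h : ∀ x y, 0 < G.weight x y → G.weight x y = a) (x y : Fin (n + 1)) :
    G.weight x y = a * G.support.weight x y := by
  by_cases h0 : 0 < G.weight x y
  · simp [support, h x y h0]
  · simp [support, h0]
    omega

theorem two_mul_numEdges (G : Multigraph n) : 2 * G.numEdges = ∑ i, ∑ j, G.weight i j := by
  have h1 : ∀ i, ∑ j, G.weight i j
      = ∑ j ∈ Finset.Ioi i, G.weight i j + ∑ j ∈ Finset.Iio i, G.weight i j := by
    intro i
    rw [← Finset.sum_union (Finset.disjoint_left.2 fun j h h' => by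
      simp only [Finset.mem_Ioi, Finset.mem_Iio] at h h'
      exact lt_asymm h h')]
    symm
    refine Finset.sum_subset (Finset.subset_univ _) fun j _ hj => ?_
    have : i = j := by
      simp only [Finset.mem_union, Finset.mem_Ioi, Finset.mem_Iio, not_or, not_lt] at hj
      exact le_antisymm hj.2 hj.1
    rw [this, G.loopless]
  have h2 : ∑ i, ∑ j ∈ Finset.Iio i, G.weight i j = ∑ i, ∑ j ∈ Finset.Ioi i, G.weight i j := by
    rw [Finset.sum_comm' (t' := Finset.univ) (s' := fun j => Finset.Ioi j) (by simp)]
    exact Finset.sum_congr rfl fun i _ => Finset.sum_congr rfl fun j _ => G.symm _ _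
  simp only [h1, Finset.sum_add_distrib, h2, numEdges, two_mul]

/-- A parent function counting every edge once gives as many edges as non-root vertices. -/
theorem numEdges_eq_of_parent {T : Multigraph n} (p : Fin (n + 1) → Fin (n + 1))
    (hp : ∀ x y, T.weight x y
      = (if x ≠ 0 ∧ p x = y then 1 else 0) + (if y ≠ 0 ∧ p y = x then 1 else 0)) :
    T.numEdges = n := by
  have h1 : ∀ x : Fin (n + 1), ∑ y, (if x ≠ 0 ∧ p x = y then 1 else 0) = if x ≠ 0 then 1 else 0 := by
    intro x
    by_cases hx : x = 0 <;> simp [hx]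
  have h2 : ∑ x : Fin (n + 1), (if x ≠ 0 then 1 else 0) = n := by
    simp [Fin.sum_univ_succ, Fin.succ_ne_zero]
  have h := two_mul_numEdges T
  simp only [hp, Finset.sum_add_distrib] at h
  rw [Finset.sum_comm (f := fun x y => if y ≠ 0 ∧ p y = x then 1 else 0)] at h
  simp only [h1, h2] at h
  omega

/-- Removing `u` as well loses at least the edges between `x` and `u`. -/
theorem attach_pair_lt {G : Multigraph n} {x u : Fin (n + 1)} (hx : 0 ≠ x) (hu : 0 ≠ u)
    (hux : u ∈ G.rootComponent {x}) (h : 0 < G.weight x u) :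
    G.attach {x, u} x < G.attach {x} x := by
  refine Finset.sum_lt_sum_of_subset (G.rootComponent_anti (by simp)) hux ?_ h
    (fun _ _ _ => Nat.zero_le _)
  exact fun h' => not_mem_of_mem_rootComponent (by simp [hx, hu]) h' (by simp)

/-- Some edge leaves the root component of G − {u, v}. Its far end is `u` or `v`, which is thus
reached without the other. -/
theorem Connected.mem_rootComponent_or {G : Multigraph n} (hG : G.Connected)
    {u v : Fin (n + 1)} (hu : 0 ≠ u) (hv : 0 ≠ v) (huv : u ≠ v) :
    u ∈ G.rootComponent {v} ∨ v ∈ G.rootComponent {u} := by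
  obtain ⟨x, hx, y, hy, h⟩ := connected_iff.1 hG _ (G.zero_mem_rootComponent {u, v})
    ⟨u, fun h => not_mem_of_mem_rootComponent (by simp [hu, hv]) h (by simp)⟩
  have hy' : y ∈ ({u, v} : Finset _) := by
    by_contra hy'
    exact hy (mem_rootComponent_of_weight_pos hx h hy')
  simp only [Finset.mem_insert, Finset.mem_singleton] at hy'
  rcases hy' with rfl | rfl
  · exact Or.inl (mem_rootComponent_of_weight_pos (G.rootComponent_anti (by simp) hx) h
      (by simpa using huv))
  · exact Or.inr (mem_rootComponent_of_weight_pos (G.rootComponent_anti (by simp) hx) h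
      (by simpa using huv.symm))

/-- If in every pair of vertices one keeps all its attachments on removal of the other, then `G`
is a multiple of a tree. -/
theorem isMulTree_of_attach {G : Multigraph n} (hG : G.Connected) {c : ℕ} (hc0 : 0 < c)
    (hc : ∀ x ≠ 0, G.attach {x} x = c)
    (h : ∀ x ≠ 0, ∀ y ≠ 0, x ≠ y → G.attach {x, y} x = c ∨ G.attach {y, x} y = c) :
    G.IsMulTree c := by
  -- If adjacent vertices were each reachable without the other, both would lose attachments in the
  -- pair.
  have h1 : ∀ x ≠ 0, ∀ u ≠ 0, u ∈ G.rootComponent {x} → 0 < G.weight x u →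
      x ∉ G.rootComponent {u} := by
    intro x hx u hu hux hw hxu
    have hne : x ≠ u := by
      rintro rfl
      simp [G.loopless] at hw
    have e1 := attach_pair_lt hx.symm hu.symm hux hw
    have e2 := attach_pair_lt hu.symm hx.symm hxu (by rwa [G.symm])
    rw [hc _ hx] at e1
    rw [hc _ hu] at e2
    rcases h x hx u hu hne with h | h <;> omega
  -- If a neighbour u of x is reachable without another neighbour v, so is x, through u; this
  -- contradicts `h1` for x and v. Of two non-root neighbours, one is always reachable without the
  -- other.
  have huniq : ∀ x ≠ 0, ∀ u ∈ G.rootComponent {x}, ∀ v ∈ G.rootComponent {x}, v ≠ 0 →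
      0 < G.weight x u → 0 < G.weight x v → u = v := by
    have aux : ∀ x ≠ 0, ∀ u ∈ G.rootComponent {x}, ∀ v ∈ G.rootComponent {x}, v ≠ 0 →
        0 < G.weight x u → 0 < G.weight x v → u ≠ v → u ∉ G.rootComponent {v} := by
      intro x hx u hu v hv hv0 hwu hwv huv huv'
      refine h1 x hx v hv0 hv hwv (mem_rootComponent_of_weight_pos huv' (by rwa [G.symm]) ?_)
      simp only [Finset.mem_singleton]
      rintro rfl
      simp [G.loopless] at hwv
    intro x hx u hu v hv hv0 hwu hwv
    by_contra huv
    have e1 := aux x hx u hu v hv hv0 hwu hwv huv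
    have hu0 : u ≠ 0 := fun h => e1 (h ▸ G.zero_mem_rootComponent _)
    have e2 := aux x hx v hv u hu hu0 hwv hwu (Ne.symm huv)
    rcases hG.mem_rootComponent_or hu0.symm hv0.symm huv with h | h
    · exact e1 h
    · exact e2 h
  have hpar : ∀ x, ∃ p, x ≠ 0 → p ∈ G.rootComponent {x} ∧ G.weight x p = c ∧
      ∀ u ∈ G.rootComponent {x}, 0 < G.weight x u → u = p := by
    intro x
    by_cases hx : x = 0
    · exact ⟨0, fun h => absurd hx h⟩
    obtain ⟨p, hp, hpw⟩ := exists_of_attach_pos (hc0.trans_eq (hc x hx).symm)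
    rw [G.symm] at hpw
    have hall : ∀ u ∈ G.rootComponent {x}, 0 < G.weight x u → u = p := by
      intro u hu huw
      by_cases hp0 : p = 0
      · by_contra hup
        exact hup (huniq x hx p hp u hu (fun h => hup (h.trans hp0.symm)) hpw huw).symm
      · exact huniq x hx u hu p hp hp0 huw hpw
    refine ⟨p, fun _ => ⟨hp, ?_, hall⟩⟩
    rw [← hc x hx, attach]
    refine (Finset.sum_eq_single_of_mem p hp fun u hu hup => ?_).symm
    by_contra hw
    exact hup (hall u hu (Nat.pos_of_ne_zero hw))
  choose p hp using hpar
  have hedge : ∀ x y, 0 < G.weight x y → (x ≠ 0 ∧ p x = y) ∨ (y ≠ 0 ∧ p y = x) := by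
    intro x y hw
    have hxy : x ≠ y := by
      rintro rfl
      simp [G.loopless] at hw
    have hw' : 0 < G.weight y x := by rwa [G.symm]
    by_cases hx : x = 0
    · have hy : y ≠ 0 := fun h => hxy (hx.trans h.symm)
      exact Or.inr ⟨hy, ((hp y hy).2.2 x (hx ▸ G.zero_mem_rootComponent _) hw').symm⟩
    by_cases hy : y = 0
    · exact Or.inl ⟨hx, ((hp x hx).2.2 y (hy ▸ G.zero_mem_rootComponent _) hw).symm⟩
    rcases hG.mem_rootComponent_or (Ne.symm hx) (Ne.symm hy) hxy with h | h
    · exact Or.inr ⟨hy, ((hp y hy).2.2 x h hw').symm⟩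
    · exact Or.inl ⟨hx, ((hp x hx).2.2 y h hw).symm⟩
  have hweight : ∀ x y, 0 < G.weight x y → G.weight x y = c := by
    intro x y hw
    rcases hedge x y hw with ⟨hx, rfl⟩ | ⟨hy, rfl⟩
    · exact (hp x hx).2.1
    · rw [G.symm]
      exact (hp y hy).2.1
  refine ⟨hc0, G.support, ⟨hG.support, numEdges_eq_of_parent p fun x y => ?_⟩,
    weight_eq_mul_support hweight⟩
  by_cases hw : 0 < G.weight x y
  · have hnot : ¬ ((x ≠ 0 ∧ p x = y) ∧ (y ≠ 0 ∧ p y = x)) := by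
      rintro ⟨⟨hx, hpx⟩, hy, hpy⟩
      have e1 := (hp x hx).1
      have e2 := (hp y hy).1
      rw [hpx] at e1
      rw [hpy] at e2
      exact h1 x hx y hy e1 hw e2
    rcases hedge x y hw with h' | h'
    · have h'' : ¬ (y ≠ 0 ∧ p y = x) := fun h'' => hnot ⟨h', h''⟩
      rw [if_pos h', if_neg h'']
      simp [support, hw]
    · have h'' : ¬ (x ≠ 0 ∧ p x = y) := fun h'' => hnot ⟨h'', h'⟩
      rw [if_pos h', if_neg h'']
      simp [support, hw]
  · have e1 : ¬ (x ≠ 0 ∧ p x = y) := by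
      rintro ⟨hx, rfl⟩
      rw [(hp x hx).2.1] at hw
      exact hw hc0
    have e2 : ¬ (y ≠ 0 ∧ p y = x) := by
      rintro ⟨hy, rfl⟩
      rw [G.symm, (hp y hy).2.1] at hw
      exact hw hc0
    rw [if_neg e1, if_neg e2]
    simp [support, hw]

/-! ### The uniform alternative: separated sets -/

/-- The vertices separated from the root by the pair `{x, y}`. -/
noncomputable def separated (G : Multigraph n) (x y : Fin (n + 1)) : Finset (Fin (n + 1)) :=
  (G.rootComponent {x, y} ∪ {x, y})ᶜ

theorem mem_separated {G : Multigraph n} {x y z : Fin (n + 1)} :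
    z ∈ G.separated x y ↔ z ∉ G.rootComponent {x, y} ∧ z ≠ x ∧ z ≠ y := by
  simp [separated, and_comm, and_assoc]

theorem separated_comm (G : Multigraph n) (x y : Fin (n + 1)) :
    G.separated x y = G.separated y x := by
  simp only [separated, Finset.pair_comm]

theorem ne_zero_of_mem_separated {G : Multigraph n} {x y z : Fin (n + 1)}
    (h : z ∈ G.separated x y) : z ≠ 0 := by
  rintro rfl
  exact (mem_separated.1 h).1 (G.zero_mem_rootComponent _)

theorem weight_eq_zero_of_mem_separated {G : Multigraph n} {x y z u : Fin (n + 1)}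
    (h : z ∈ G.separated x y) (hu : u ∈ G.rootComponent {x, y}) : G.weight u z = 0 := by
  by_contra hw
  obtain ⟨h1, h2, h3⟩ := mem_separated.1 h
  exact h1 (mem_rootComponent_of_weight_pos hu (Nat.pos_of_ne_zero hw) (by simp [h2, h3]))

/-- The root component of G − {x, y} avoids `z`, so it survives in G − {x, z}, where it also absorbs
`y` because `y` is attached to it. Nothing new is separated, and `z` itself drops out. This drives
the induction. -/
theorem separated_ssubset {G : Multigraph n} {x y z : Fin (n + 1)}
    (hxy : x ≠ y) (hA : 0 < G.attach {y, x} y) (hz : z ∈ G.separated x y) :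
    G.separated x z ⊂ G.separated x y := by
  obtain ⟨hz1, hz2, hz3⟩ := mem_separated.1 hz
  have hsub : ∀ v ∈ G.rootComponent {x, y}, v ∈ G.rootComponent {x, z} := by
    intro v hv
    refine rootComponent_induction (P := fun v => v ∈ G.rootComponent {x, z})
      (G.zero_mem_rootComponent _) (fun u v hu hu' huv hv => ?_) hv
    refine mem_rootComponent_of_weight_pos hu' huv ?_
    have := mem_rootComponent_of_weight_pos hu huv hv
    simp only [Finset.mem_insert, Finset.mem_singleton, not_or] at hv ⊢
    exact ⟨hv.1, fun h => hz1 (h ▸ this)⟩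
  have hy' : y ∈ G.rootComponent {x, z} := by
    obtain ⟨u, hu, hw⟩ := exists_of_attach_pos hA
    rw [Finset.pair_comm] at hu
    exact mem_rootComponent_of_weight_pos (hsub u hu) hw (by simp [hxy.symm, hz3.symm])
  rw [Finset.ssubset_iff_of_subset]
  · exact ⟨z, hz, fun h => (mem_separated.1 h).2.2 rfl⟩
  · intro u hu
    obtain ⟨h1, h2, h3⟩ := mem_separated.1 hu
    exact mem_separated.2 ⟨fun h => h1 (hsub u h), h2, fun h => h1 (h ▸ hy')⟩

theorem sum_weight_eq (G : Multigraph n) {x y : Fin (n + 1)} (hx : 0 ≠ x) (hy : 0 ≠ y)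
    (hxy : x ≠ y) : ∑ u, G.weight x u
      = G.attach {x, y} x + G.weight x y + ∑ u ∈ G.separated x y, G.weight x u := by
  have hd : Disjoint (G.rootComponent {x, y}) {x, y} := Finset.disjoint_left.2 fun v hv =>
    not_mem_of_mem_rootComponent (by simp [hx, hy]) hv
  rw [← Finset.sum_add_sum_compl (G.rootComponent {x, y} ∪ {x, y}), Finset.sum_union hd,
    Finset.sum_pair hxy, G.loopless, zero_add]
  rfl

/-- All pairs of non-root vertices have the same attachment number, strictly between `0` and
the common degree of the non-root vertices. -/
structure UniformAttach (G : Multigraph n) (A b : ℕ) : Prop where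
  two_le : 2 ≤ n
  A_pos : 0 < A
  b_pos : 0 < b
  connected : G.Connected
  attach_singleton : ∀ x ≠ 0, G.attach {x} x = A + b
  attach_pair : ∀ x ≠ 0, ∀ y ≠ 0, x ≠ y → G.attach {x, y} x = A

namespace UniformAttach

variable {G : Multigraph n} {A b : ℕ}

/-- As A > 0, `x` has a neighbour reachable without `x` and `y`: no non-root vertex is a cut vertex.
-/
theorem mem_rootComponent (h : G.UniformAttach A b) {x y : Fin (n + 1)} (hy : y ≠ 0)
    (hxy : x ≠ y) : x ∈ G.rootComponent {y} := by
  by_cases hx : x = 0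
  · exact hx ▸ G.zero_mem_rootComponent _
  obtain ⟨u, hu, hw⟩ := exists_of_attach_pos (h.A_pos.trans_eq (h.attach_pair x hx y hy hxy).symm)
  exact mem_rootComponent_of_weight_pos (G.rootComponent_anti (by simp) hu) hw (by simpa using hxy)

theorem sum_weight (h : G.UniformAttach A b) {x : Fin (n + 1)} (hx : x ≠ 0) :
    ∑ u, G.weight x u = A + b := by
  rw [← h.attach_singleton x hx, attach]
  symm
  refine Finset.sum_subset (Finset.subset_univ _) fun u _ hu => ?_
  by_cases hux : u = x
  · rw [hux, G.loopless]
  · exact absurd (h.mem_rootComponent hx hux) hu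

theorem weight_add_sum (h : G.UniformAttach A b) {x y : Fin (n + 1)} (hx : x ≠ 0) (hy : y ≠ 0)
    (hxy : x ≠ y) : G.weight x y + ∑ u ∈ G.separated x y, G.weight x u = b := by
  have := G.sum_weight_eq hx.symm hy.symm hxy
  rw [h.sum_weight hx, h.attach_pair x hx y hy hxy] at this
  omega

theorem separated_ssubset (h : G.UniformAttach A b) {x y z : Fin (n + 1)} (hx : x ≠ 0)
    (hy : y ≠ 0) (hxy : x ≠ y) (hz : z ∈ G.separated x y) :
    G.separated x z ⊂ G.separated x y :=
  Multigraph.separated_ssubset hxy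
    (h.A_pos.trans_eq (h.attach_pair y hy x hx hxy.symm).symm) hz

theorem weight_root_le (h : G.UniformAttach A b) {x : Fin (n + 1)} (hx : x ≠ 0) :
    G.weight x 0 ≤ A := by
  obtain ⟨y, hy, hxy⟩ : ∃ y : Fin (n + 1), y ≠ 0 ∧ x ≠ y := by
    have h2 := h.two_le
    by_cases hx1 : x = ⟨1, by omega⟩
    · exact ⟨⟨2, by omega⟩, by simp [Fin.ext_iff], by simp [hx1]⟩
    · exact ⟨⟨1, by omega⟩, by simp [Fin.ext_iff], hx1⟩
  rw [← h.attach_pair x hx y hy hxy]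
  exact Finset.single_le_sum (f := fun u => G.weight x u) (fun _ _ => Nat.zero_le _)
    (G.zero_mem_rootComponent _)

/-- With nothing separated, `weight_add_sum` makes non-root weights equal b; equal degrees then make
root weights equal, and connectedness makes them positive. -/
theorem eq_completeMul (h : G.UniformAttach A b)
    (hs : ∀ x ≠ 0, ∀ y ≠ 0, x ≠ y → G.separated x y = ∅) :
    ∃ a, 1 ≤ a ∧ G = completeMul n a b := by
  have hw : ∀ x ≠ 0, ∀ y ≠ 0, x ≠ y → G.weight x y = b := by
    intro x hx y hy hxy
    have := h.weight_add_sum hx hy hxy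
    rwa [hs x hx y hy hxy, Finset.sum_empty, add_zero] at this
  have h0 : ∀ i : Fin n, G.weight i.succ 0 + (n - 1) * b = A + b := by
    intro i
    rw [← h.sum_weight (Fin.succ_ne_zero i), Fin.sum_univ_succ,
      ← Finset.sum_erase_add _ _ (Finset.mem_univ i), G.loopless,
      Finset.sum_congr rfl (g := fun _ => b)]
    · simp
    · intro j hj
      exact hw _ (Fin.succ_ne_zero _) _ (Fin.succ_ne_zero _)
        (fun h' => (Finset.mem_erase.1 hj).1 (Fin.succ_inj.1 h').symm)
  obtain ⟨u, hu, v, hv, huv⟩ := connected_iff.1 h.connected {0} (by simp)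
    ⟨(⟨0, by have := h.two_le; omega⟩ : Fin n).succ, by simp⟩
  simp only [Finset.mem_singleton] at hu hv
  obtain ⟨k, rfl⟩ := Fin.exists_succ_eq.2 hv
  rw [hu, G.symm] at huv
  have h0' : ∀ i : Fin n, G.weight i.succ 0 = G.weight k.succ 0 := fun i => by
    have := h0 i
    have := h0 k
    omega
  refine ⟨G.weight k.succ 0, huv, ?_⟩
  ext x y
  simp only [completeMul]
  split_ifs with hxy hor
  · rw [hxy, G.loopless]
  · rcases hor with hx | hy
    · obtain ⟨i, rfl⟩ := Fin.exists_succ_eq.2 (fun h : y = 0 => hxy (hx.trans h.symm))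
      rw [hx, G.symm, h0' i]
    · obtain ⟨i, rfl⟩ := Fin.exists_succ_eq.2 (fun h : x = 0 => hxy (h.trans hy.symm))
      rw [hy, h0' i]
  · push Not at hor
    exact hw x hor.1 y hor.2 hxy

theorem separated_induction {P : Fin (n + 1) → Fin (n + 1) → Prop} (h : G.UniformAttach A b)
    (hstep : ∀ x ≠ 0, ∀ y ≠ 0, x ≠ y →
      (∀ z ∈ G.separated x y, z ≠ x → z ≠ y → P x z ∧ P y z) → P x y) :
    ∀ x ≠ 0, ∀ y ≠ 0, x ≠ y → P x y := by
  suffices H : ∀ m : ℕ, ∀ x ≠ 0, ∀ y ≠ 0, x ≠ y → (G.separated x y).card = m → P x y from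
    fun x hx y hy hxy => H _ x hx y hy hxy rfl
  intro m
  induction m using Nat.strong_induction_on with
  | _ m ih =>
    intro x hx y hy hxy hm
    refine hstep x hx y hy hxy fun z hz hzx hzy => ⟨?_, ?_⟩
    · exact ih _ (hm ▸ Finset.card_lt_card (h.separated_ssubset hx hy hxy hz)) x hx z
        (ne_zero_of_mem_separated hz) hzx.symm rfl
    · rw [separated_comm] at hz hm
      exact ih _ (hm ▸ Finset.card_lt_card (h.separated_ssubset hy hx hxy.symm hz)) y hy z
        (ne_zero_of_mem_separated hz) hzy.symm rfl

/-- If A ≠ b, induction says that {x, u} and {y, u} separate nothing for each separated u, so w(x,u)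
= w(y,u) = b. The total b at `x` leaves room for a single such u = z, whose only neighbours are x
and y. Its degree gives 2b = A + b. -/
theorem A_eq_b (h : G.UniformAttach A b) : ∀ x ≠ 0, ∀ y ≠ 0, x ≠ y →
    (G.separated x y).Nonempty → A = b := by
  refine h.separated_induction fun x hx y hy hxy ih ⟨z, hz⟩ => ?_
  by_contra hne
  have hw : ∀ u ∈ G.separated x y, G.weight x u = b ∧ G.weight y u = b := by
    intro u hu
    obtain ⟨-, hux, huy⟩ := mem_separated.1 hu
    have hu0 := ne_zero_of_mem_separated hu
    obtain ⟨h1, h2⟩ := ih u hu hux huy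
    constructor
    · have := h.weight_add_sum hx hu0 hux.symm
      rwa [Finset.not_nonempty_iff_eq_empty.1 (fun h' => hne (h1 h')), Finset.sum_empty,
        add_zero] at this
    · have := h.weight_add_sum hy hu0 huy.symm
      rwa [Finset.not_nonempty_iff_eq_empty.1 (fun h' => hne (h2 h')), Finset.sum_empty,
        add_zero] at this
  have h1 := h.weight_add_sum hx hy hxy
  rw [← Finset.add_sum_erase _ _ hz, (hw z hz).1] at h1
  have hsing : ∀ u, u ≠ x → u ≠ y → G.weight z u = 0 := by
    intro u hux huy
    rw [G.symm]
    by_cases hu : u ∈ G.rootComponent {x, y}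
    · exact weight_eq_zero_of_mem_separated hz hu
    have hu' := mem_separated.2 ⟨hu, hux, huy⟩
    by_cases huz : u = z
    · rw [huz, G.loopless]
    exfalso
    have := Finset.single_le_sum (f := fun j => G.weight x j) (fun _ _ => Nat.zero_le _)
      (Finset.mem_erase.2 ⟨huz, hu'⟩)
    rw [(hw u hu').1] at this
    have := h.b_pos
    omega
  have h2 := h.sum_weight (ne_zero_of_mem_separated hz)
  rw [Finset.sum_eq_add_of_mem x y (Finset.mem_univ _) (Finset.mem_univ _) hxy
    (fun u _ hu => hsing u hu.1 hu.2), G.symm z x, G.symm z y, (hw z hz).1, (hw z hz).2] at h2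
  omega

/-! ### The cycle alternative -/

/-- If 0 < w(x,y) < b, the remainder of b is carried by separated vertices; one of them has weight
to `x` strictly between 0 and b, against the induction hypothesis. -/
theorem weight_eq_zero_or (h : G.UniformAttach A b) : ∀ x ≠ 0, ∀ y ≠ 0, x ≠ y →
    G.weight x y = 0 ∨ G.weight x y = b := by
  refine h.separated_induction fun x hx y hy hxy ih => ?_
  by_contra! hw
  have h1 := h.weight_add_sum hx hy hxy
  obtain ⟨z, hz, hzw⟩ : ∃ z ∈ G.separated x y, G.weight x z ≠ 0 :=
    Finset.exists_ne_zero_of_sum_ne_zero (by omega)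
  have h2 := Finset.single_le_sum (f := fun u => G.weight x u) (fun _ _ => Nat.zero_le _) hz
  obtain ⟨-, hzx, hzy⟩ := mem_separated.1 hz
  have := (ih z hz hzx hzy).1
  omega

/-- The degree 2b and the other weights are multiples of b, so the root weight is too; being at most
A = b, it cannot be 2b. -/
theorem weight_root_eq_zero_or (h : G.UniformAttach b b) {x : Fin (n + 1)} (hx : x ≠ 0) :
    G.weight x 0 = 0 ∨ G.weight x 0 = b := by
  have h1 := h.sum_weight hx
  rw [Fin.sum_univ_succ] at h1
  have hle := h.weight_root_le hx
  have hdvd : b ∣ ∑ i : Fin n, G.weight x i.succ := by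
    refine Finset.dvd_sum fun i _ => ?_
    by_cases hi : x = i.succ
    · rw [← hi, G.loopless]
      exact dvd_zero b
    · rcases h.weight_eq_zero_or x hx _ (Fin.succ_ne_zero i) hi with h' | h' <;> simp [h']
  have hd : b ∣ G.weight x 0 := by
    rw [← Nat.dvd_add_left hdvd, h1]
    exact ⟨2, by ring⟩
  rcases Nat.eq_zero_or_pos (G.weight x 0) with h0 | h0
  · exact Or.inl h0
  · exact Or.inr (le_antisymm hle (Nat.le_of_dvd h0 hd))

theorem weight_eq_of_pos (h : G.UniformAttach b b) (x y : Fin (n + 1)) (hw : 0 < G.weight x y) :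
    G.weight x y = b := by
  by_cases hx : x = 0
  · by_cases hy : y = 0
    · rw [hx, hy, G.loopless] at hw
      exact absurd hw (lt_irrefl 0)
    · subst hx
      rw [G.symm] at hw ⊢
      have := h.weight_root_eq_zero_or hy
      omega
  · by_cases hy : y = 0
    · subst hy
      have := h.weight_root_eq_zero_or hx
      omega
    · have hxy : x ≠ y := by
        rintro rfl
        simp [G.loopless] at hw
      have := h.weight_eq_zero_or x hx y hy hxy
      omega

/-- A neighbour of the root has no further neighbour connected to the root outside a pair. -/
theorem weight_eq_zero_of_root_neighbor (h : G.UniformAttach b b) {i j u : Fin (n + 1)}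
    (hi : i ≠ 0) (hj : j ≠ 0) (hij : i ≠ j) (hwi : 0 < G.weight i 0) (hu : u ≠ 0)
    (huc : u ∈ G.rootComponent {i, j}) : G.weight i u = 0 := by
  -- The edges to the root already exhaust the attachment number b.
  have h1 := h.attach_pair i hi j hj hij
  rw [attach, ← Finset.add_sum_erase _ _ (G.zero_mem_rootComponent _),
    h.weight_eq_of_pos _ _ hwi] at h1
  have := Finset.single_le_sum (f := fun j => G.weight i j) (fun _ _ => Nat.zero_le _)
      (Finset.mem_erase.2 ⟨hu, huc⟩)
  omega

/-- A path from the root avoiding i can be restarted from the root at its last visit to j or k, so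
every vertex other than i is reachable avoiding {i, j} or {i, k}. Hence i has no neighbour but the
root, and its degree is b instead of 2b. -/
theorem not_three_root_neighbors (h : G.UniformAttach b b) {i j k : Fin (n + 1)}
    (hi : 0 < G.weight i 0) (hj : 0 < G.weight j 0) (hk : 0 < G.weight k 0)
    (hij : i ≠ j) (hik : i ≠ k) (hjk : j ≠ k) : False := by
  have hne : ∀ {x}, 0 < G.weight x 0 → x ≠ 0 := by
    rintro x hx rfl
    simp [G.loopless] at hx
  have hadj : ∀ x S, 0 < G.weight x 0 → x ∉ S → x ∈ G.rootComponent S := fun x S hx hxS =>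
    mem_rootComponent_of_weight_pos (G.zero_mem_rootComponent S) (by rwa [G.symm]) hxS
  have hcover : ∀ v, v ≠ i → v ∈ G.rootComponent {i, j} ∨ v ∈ G.rootComponent {i, k} := by
    intro v hv
    refine rootComponent_induction
      (P := fun v => v ∈ G.rootComponent {i, j} ∨ v ∈ G.rootComponent {i, k})
      (Or.inl (G.zero_mem_rootComponent _)) (fun u v _ hu huv hvi => ?_)
      (h.mem_rootComponent (hne hi) hv)
    rw [Finset.mem_singleton] at hvi
    by_cases hvj : v = j
    · exact Or.inr (hvj ▸ hadj j _ hj (by simp [hij.symm, hjk]))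
    by_cases hvk : v = k
    · exact Or.inl (hvk ▸ hadj k _ hk (by simp [hik.symm, hjk.symm]))
    exact hu.imp (fun hu => mem_rootComponent_of_weight_pos hu huv (by simp [hvi, hvj]))
      (fun hu => mem_rootComponent_of_weight_pos hu huv (by simp [hvi, hvk]))
  have h1 := h.sum_weight (hne hi)
  rw [Finset.sum_eq_single 0, h.weight_eq_of_pos _ _ hi] at h1
  · have := h.b_pos
    omega
  · intro u _ hu
    by_cases hui : u = i
    · rw [hui, G.loopless]
    · rcases hcover u hui with h' | h'
      · exact h.weight_eq_zero_of_root_neighbor (hne hi) (hne hj) hij hi hu h'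
      · exact h.weight_eq_zero_of_root_neighbor (hne hi) (hne hk) hik hi hu h'
  · simp

theorem sum_weight_root (h : G.UniformAttach b b) : ∑ u, G.weight 0 u = 2 * b := by
  -- Otherwise the root would be isolated once i is removed, yet a third vertex m remains reachable.
  -- The value i = 0 yields a first neighbour from connectedness.
  have hstep : ∀ i, ∃ k, k ≠ i ∧ 0 < G.weight k 0 := by
    intro i
    obtain ⟨m, hm⟩ : ∃ m : Fin (n + 1), m ∉ ({0, i} : Finset (Fin (n + 1))) := by
      by_contra! hall
      have := Finset.card_le_card (s := Finset.univ) (fun m _ => hall m)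
      have := Finset.card_le_two (a := (0 : Fin (n + 1))) (b := i)
      have := h.two_le
      simp only [Finset.card_univ, Fintype.card_fin] at *
      omega
    simp only [Finset.mem_insert, Finset.mem_singleton, not_or] at hm
    by_contra! hno
    refine hm.1 ?_
    have hmem : m ∈ G.rootComponent {i} := by
      by_cases hi : i = 0
      · exact False.elim (by
          obtain ⟨u, hu, v, hv, hw⟩ := connected_iff.1 h.connected {0} (by simp) ⟨m, by simp [hm]⟩
          simp only [Finset.mem_singleton] at hu hv
          have := hno v (hi ▸ hv)
          rw [hu, G.symm] at hw
          omega)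
      · exact h.mem_rootComponent hi hm.2
    refine rootComponent_induction (P := fun v => v = 0) rfl (fun u v _ hu huv hv => ?_) hmem
    have := hno v (by simpa using hv)
    rw [hu, G.symm] at huv
    omega
  obtain ⟨i, -, hi⟩ := hstep 0
  obtain ⟨j, hji, hj⟩ := hstep i
  rw [Finset.sum_eq_add_of_mem i j (Finset.mem_univ _) (Finset.mem_univ _) hji.symm,
    G.symm, G.symm 0 j, h.weight_eq_of_pos _ _ hi, h.weight_eq_of_pos _ _ hj, two_mul]
  intro k _ hk
  by_contra hw
  rw [G.symm] at hw
  exact h.not_three_root_neighbors hi hj (Nat.pos_of_ne_zero hw) hji.symm hk.1.symm hk.2.symm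

theorem isMulCycle (h : G.UniformAttach b b) : G.IsMulCycle b := by
  have hb := h.b_pos
  have hw := weight_eq_mul_support h.weight_eq_of_pos
  refine ⟨hb, G.support, ⟨h.connected.support, fun x => ?_⟩, hw⟩
  have hs : ∑ u, G.weight x u = 2 * b := by
    by_cases hx : x = 0
    · rw [hx, h.sum_weight_root]
    · rw [h.sum_weight hx, two_mul]
  have hd : G.support.degree x = ∑ u, G.support.weight x u := by
    rw [degree, degOut, ← Finset.sum_compl_add_sum {x}, Finset.sum_singleton,
      G.support.loopless, add_zero]
  simp only [hw, ← Finset.mul_sum] at hs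
  rw [hd]
  exact Nat.eq_of_mul_eq_mul_left hb (hs.trans (mul_comm _ _))

/-- Either `G` is a weighted complete graph or a multiple of a cycle. -/
theorem complete_or_cycle (h : G.UniformAttach A b) :
    (∃ a, 1 ≤ a ∧ G = completeMul n a b) ∨ A = b := by
  by_cases hs : ∀ x ≠ 0, ∀ y ≠ 0, x ≠ y → G.separated x y = ∅
  · exact Or.inl (h.eq_completeMul hs)
  · push Not at hs
    obtain ⟨x, hx, y, hy, hxy, hne⟩ := hs
    exact Or.inr (h.A_eq_b x hx y hy hxy hne)

end UniformAttach

end Multigraph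

/-! ### Vector parking functions -/

section VectorParking

variable {n : ℕ}

theorem permInvariant_vectorParkingFunctions (x : Fin n → ℕ) :
    PermInvariant (vectorParkingFunctions x) := by
  rintro σ α ⟨τ, hmono, h⟩
  refine ⟨τ.trans σ, ?_, fun j => by simpa using h j⟩
  convert hmono using 1
  funext k
  simp

theorem mem_vectorParkingFunctions_iff_sort {x α : Fin n → ℕ} :
    α ∈ vectorParkingFunctions x ↔ ∀ j, α (Tuple.sort α j) < ∑ i ∈ Finset.Iic j, x i := by
  refine ⟨?_, fun h => ⟨Tuple.sort α, Tuple.monotone_sort α, h⟩⟩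
  rintro ⟨τ, hmono, h⟩ j
  have : α ∘ τ = α ∘ Tuple.sort α := Tuple.unique_monotone hmono (Tuple.monotone_sort α)
  exact (congrFun this j).symm.trans_lt (h j)

theorem sum_Iic_headVec (a b : ℕ) (j : Fin n) :
    ∑ i ∈ Finset.Iic j, headVec n a b i = a + j * b := by
  have h0 : 0 < n := Fin.pos j
  rw [← Finset.add_sum_erase _ _ (Finset.mem_Iic.2 (show (⟨0, h0⟩ : Fin n) ≤ j from Nat.zero_le _)),
    Finset.sum_congr rfl (g := fun _ => b)]
  · have hmem : (⟨0, h0⟩ : Fin n) ∈ Finset.Iic j := Finset.mem_Iic.2 (Nat.zero_le _)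
    rw [Finset.sum_const, Finset.card_erase_of_mem hmem, Fin.card_Iic]
    simp [headVec]
  · intro i hi
    have : (i : ℕ) ≠ 0 := fun h => (Finset.mem_erase.1 hi).1 (Fin.ext h)
    simp [headVec, this]

theorem sum_Iic_endsVec (hn : 2 ≤ n) (a : ℕ) (j : Fin n) :
    ∑ i ∈ Finset.Iic j, endsVec n a i = if (j : ℕ) + 1 = n then 2 * a else a := by
  have h0 : 0 < n := by omega
  rw [← Finset.add_sum_erase _ _ (Finset.mem_Iic.2 (show (⟨0, h0⟩ : Fin n) ≤ j from Nat.zero_le _))]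
  split_ifs with hj
  · rw [Finset.sum_eq_single j]
    · simp [endsVec, hj, two_mul]
    · intro i hi hij
      simp only [Finset.mem_erase, Finset.mem_Iic, ne_eq, Fin.ext_iff, Fin.le_def] at hi hij
      simp only [endsVec]
      rw [if_neg (by omega)]
    · intro h
      simp only [Finset.mem_erase, Finset.mem_Iic, ne_eq, Fin.ext_iff, Fin.le_def] at h
      omega
  · rw [Finset.sum_eq_zero]
    · simp [endsVec]
    · intro i hi
      simp only [Finset.mem_erase, Finset.mem_Iic, ne_eq, Fin.ext_iff, Fin.le_def] at hi
      have := j.2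
      simp only [endsVec]
      rw [if_neg (by omega)]

theorem mem_vectorParkingFunctions_headVec_zero {a : ℕ} {α : Fin n → ℕ} :
    α ∈ vectorParkingFunctions (headVec n a 0) ↔ ∀ i, α i < a := by
  simp only [mem_vectorParkingFunctions_iff_sort, sum_Iic_headVec, mul_zero, add_zero]
  exact (Tuple.sort α).forall_congr_left.trans (by simp)

/-- The partial sums are a, …, a, 2a, so only the largest entry may reach a. -/
theorem mem_vectorParkingFunctions_endsVec (hn : 2 ≤ n) {a : ℕ} {α : Fin n → ℕ} :
    α ∈ vectorParkingFunctions (endsVec n a) ↔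
      (∀ i, α i < 2 * a) ∧ ∀ i j, i ≠ j → α i < a ∨ α j < a := by
  simp only [mem_vectorParkingFunctions_iff_sort, sum_Iic_endsVec hn]
  constructor
  · intro h
    refine ⟨(Tuple.sort α).surjective.forall.2 fun k => ?_,
      (Tuple.sort α).surjective.forall₂.2 fun k l hkl => ?_⟩
    · have := h k
      split_ifs at this <;> omega
    · have h1 := h k
      have h2 := h l
      have hkl' : (k : ℕ) ≠ l := fun h => hkl (congrArg _ (Fin.ext h))
      split_ifs at h1 h2 <;> omega
  · rintro ⟨h1, h2⟩ j
    split_ifs with hj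
    · exact h1 _
    · have hlt : (j : ℕ) < n - 1 := by have := j.2; omega
      have hle : α (Tuple.sort α j) ≤ α (Tuple.sort α ⟨n - 1, by omega⟩) :=
        Tuple.monotone_sort α (show (j : ℕ) ≤ n - 1 from hlt.le)
      have := h2 (Tuple.sort α j) (Tuple.sort α ⟨n - 1, by omega⟩) fun h => by
        have := congrArg Fin.val ((Tuple.sort α).injective h)
        exact hlt.ne this
      omega

theorem const_mem_headVec {a b : ℕ} {k : ℕ} (hk : (fun _ => k) ∈
    vectorParkingFunctions (headVec n a b)) (hn : 0 < n) : k < a := by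
  obtain ⟨τ, -, h⟩ := hk
  simpa [sum_Iic_headVec] using h ⟨0, hn⟩

/-- This sequence attains every bound, so its later entries tell (a, b, …, b) from the other
vectors. Positivity of `a` keeps the truncated subtraction exact. -/
theorem staircase_mem_headVec {a : ℕ} (ha : 1 ≤ a) (b : ℕ) :
    (fun i : Fin n => a + i * b - 1) ∈ vectorParkingFunctions (headVec n a b) := by
  refine ⟨1, fun i j hij => ?_, fun j => ?_⟩
  · have : (i : ℕ) * b ≤ j * b := Nat.mul_le_mul_right b hij
    simp only [Function.comp_apply, Equiv.Perm.one_apply]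
    omega
  · rw [sum_Iic_headVec]
    simp only [Equiv.Perm.one_apply]
    omega

end VectorParking

/-! ### Parking functions of the three families -/

namespace Multigraph

variable {n : ℕ}

theorem Connected.exists_out {G : Multigraph n} (hG : G.Connected) {X : Finset (Fin (n + 1))}
    (h0 : 0 ∈ X) (hX : ∃ v, v ∉ X) :
    ∃ i : Fin n, i.succ ∉ X ∧ ∃ u ∈ X, 0 < G.weight i.succ u := by
  obtain ⟨u, hu, v, hv, h⟩ := connected_iff.1 hG X h0 hX
  obtain ⟨i, rfl⟩ := Fin.exists_succ_eq.2 (fun h : v = 0 => hv (h ▸ h0))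
  exact ⟨i, hv, u, hu, by rwa [G.symm]⟩

theorem weight_le_sum (G : Multigraph n) {X : Finset (Fin (n + 1))} {u : Fin (n + 1)}
    (hu : u ∈ X) (v : Fin (n + 1)) : G.weight v u ≤ ∑ j ∈ X, G.weight v j :=
  Finset.single_le_sum (f := fun j => G.weight v j) (fun _ _ => Nat.zero_le _) hu

/-- A vertex with one edge into X has at least a edges into X, so entries below a are never blocked.
-/
theorem parkingFunctions_eq_of_dvd {G : Multigraph n} (hG : G.Connected) {a : ℕ}
    (hdvd : ∀ x y, a ∣ G.weight x y) (ha : ∀ x ≠ 0, G.attach {x} x = a) :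
    G.parkingFunctions = vectorParkingFunctions (headVec n a 0) := by
  ext α
  rw [mem_vectorParkingFunctions_headVec_zero]
  refine ⟨fun h i => (lt_attach_of_mem h i).trans_eq (ha _ (Fin.succ_ne_zero _)), fun h => ?_⟩
  rw [mem_parkingFunctions_iff]
  intro X h0 hX
  obtain ⟨i, hi, u, hu, hw⟩ := hG.exists_out h0 hX
  exact ⟨i, hi, (h i).trans_le ((Nat.le_of_dvd hw (hdvd _ _)).trans (G.weight_le_sum hu _))⟩

theorem UniformAttach.parkingFunctions_eq {G : Multigraph n} {b : ℕ} (h : G.UniformAttach b b) :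
    G.parkingFunctions = vectorParkingFunctions (endsVec n b) := by
  ext α
  rw [mem_vectorParkingFunctions_endsVec h.two_le]
  constructor
  · refine fun hα => ⟨fun i => ?_, fun i j hij => ?_⟩
    · have := lt_attach_of_mem hα i
      rwa [h.attach_singleton _ (Fin.succ_ne_zero _), ← two_mul] at this
    · have hij' : i.succ ≠ j.succ := fun h => hij (Fin.succ_inj.1 h)
      obtain ⟨l, hl, hlt⟩ := exists_lt_attach hα (S := {i.succ, j.succ})
        (by simp [(Fin.succ_ne_zero _).symm]) (by simp)
      simp only [Finset.mem_insert, Finset.mem_singleton, Fin.succ_inj] at hl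
      rcases hl with rfl | rfl
      · rw [h.attach_pair _ (Fin.succ_ne_zero _) _ (Fin.succ_ne_zero _) hij'] at hlt
        exact Or.inl hlt
      · rw [Finset.pair_comm,
          h.attach_pair _ (Fin.succ_ne_zero _) _ (Fin.succ_ne_zero _) hij'.symm] at hlt
        exact Or.inr hlt
  · rintro ⟨h1, h2⟩
    rw [mem_parkingFunctions_iff]
    intro X h0 hX
    obtain ⟨i, hi, u, hu, hw⟩ := h.connected.exists_out h0 hX
    have hbi := (h.weight_eq_of_pos _ _ hw).symm.trans_le (G.weight_le_sum hu i.succ)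
    by_cases hαi : α i < b
    · exact ⟨i, hi, by omega⟩
    by_cases hXi : ∃ v, v ∉ X ∧ v ≠ i.succ
    · obtain ⟨v, hv, hvi⟩ := hXi
      -- As i is not a cut vertex, a second vertex outside X is adjacent to X; at most one of the
      -- two entries reaches b.
      obtain ⟨j, hj, hji, u, hu, hw⟩ : ∃ j : Fin n, j.succ ∉ X ∧ j ≠ i ∧
          ∃ u ∈ X, 0 < G.weight j.succ u := by
        by_contra! hno
        refine hv (rootComponent_induction (P := fun v => v ∈ X) h0
          (fun u v _ hu huv hvi => ?_) (h.mem_rootComponent (Fin.succ_ne_zero i) hvi))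
        by_contra hvX
        obtain ⟨j, rfl⟩ := Fin.exists_succ_eq.2 (fun h : v = 0 => hvX (h ▸ h0))
        have := hno j hvX (fun h => hvi (by simp [h])) u hu
        rw [G.symm] at huv
        omega
      have hbj := (h.weight_eq_of_pos _ _ hw).symm.trans_le (G.weight_le_sum hu j.succ)
      have := h2 i j hji.symm
      exact ⟨j, hj, by omega⟩
    · push Not at hXi
      -- Only i lies outside X, so all its 2b edges end in X.
      refine ⟨i, hi, (h1 i).trans_eq ?_⟩
      rw [two_mul, ← h.sum_weight (Fin.succ_ne_zero i)]
      symm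
      refine Finset.sum_subset (Finset.subset_univ X) fun v _ hv => ?_
      rw [hXi v hv, G.loopless]

theorem sum_weight_completeMul (a b : ℕ) {X : Finset (Fin (n + 1))} (h0 : 0 ∈ X)
    {x : Fin (n + 1)} (hx : x ∉ X) :
    ∑ j ∈ X, (completeMul n a b).weight x j = a + (X.card - 1) * b := by
  have hx0 : x ≠ 0 := fun h => hx (h ▸ h0)
  rw [← Finset.add_sum_erase _ _ h0, Finset.sum_congr rfl (g := fun _ => b)]
  · simp [completeMul, hx0, Finset.card_erase_of_mem h0]
  · intro j hj
    have hxj : x ≠ j := by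
      rintro rfl
      exact hx (Finset.mem_of_mem_erase hj)
    simp [completeMul, hxj, hx0, Finset.ne_of_mem_erase hj]

theorem card_compl_nonrootSet (U : Finset (Fin n)) : (nonrootSet U)ᶜ.card - 1 = n - U.card := by
  rw [Finset.card_compl, nonrootSet, Finset.card_map, Fintype.card_fin]
  omega

theorem mem_parkingFunctions_completeMul {a b : ℕ} {α : Fin n → ℕ} :
    α ∈ (completeMul n a b).parkingFunctions ↔
      ∀ U : Finset (Fin n), U.Nonempty → ∃ i ∈ U, α i < a + (n - U.card) * b := by
  refine forall_congr' fun U => forall_congr' fun _ => exists_congr fun i => and_congr_right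
    fun hi => ?_
  rw [degOut, sum_weight_completeMul a b (by simp [zero_not_mem_nonrootSet])
    (by simpa [succ_mem_nonrootSet] using hi), card_compl_nonrootSet]

theorem parkingFunctions_completeMul (n a b : ℕ) :
    (completeMul n a b).parkingFunctions = vectorParkingFunctions (headVec n a b) := by
  ext α
  rw [mem_parkingFunctions_completeMul, mem_vectorParkingFunctions_iff_sort]
  simp only [sum_Iic_headVec]
  set τ := Tuple.sort α with hτ
  have hmono : Monotone (α ∘ τ) := Tuple.monotone_sort α
  constructor
  · intro h j
    -- The bound depends only on the size of U, so the strictest test takes the positions of the n −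
    -- j largest entries.
    obtain ⟨i, hi, hlt⟩ := h ((Finset.Ici j).map τ.toEmbedding) (by simp)
    obtain ⟨k, hk, rfl⟩ := Finset.mem_map.1 hi
    rw [Finset.card_map, Fin.card_Ici, Nat.sub_sub_self j.2.le] at hlt
    exact (hmono (Finset.mem_Ici.1 hk)).trans_lt hlt
  · intro h U hU
    -- The smallest entry of U in sorted order works: U lies in the final segment starting there,
    -- which bounds its size.
    obtain ⟨j, hj, hmin⟩ := (U.map τ.symm.toEmbedding).exists_minimal (hU.map)
    obtain ⟨i, hi, rfl⟩ := Finset.mem_map.1 hj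
    have hsub : U.map τ.symm.toEmbedding ⊆ Finset.Ici (τ.symm.toEmbedding i) := fun k hk => by
      rw [Finset.mem_Ici]
      rcases le_total (τ.symm.toEmbedding i) k with hle | hle
      · exact hle
      · exact hmin hk hle
    have hcard := Finset.card_le_card hsub
    rw [Finset.card_map, Fin.card_Ici] at hcard
    refine ⟨i, hi, ?_⟩
    have := h (τ.symm.toEmbedding i)
    simp only [Equiv.coe_toEmbedding, Equiv.apply_symm_apply] at this hcard
    refine this.trans_le (Nat.add_le_add_left (Nat.mul_le_mul_right _ ?_) _)
    have := (τ.symm i).2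
    omega

/-! ### Classification and mutual exclusion -/

/-- The classification of connected multigraphs with invariant parking functions. -/
theorem classification (hn : 1 ≤ n) {G : Multigraph n} (hG : G.Connected)
    (hinv : PermInvariant G.parkingFunctions) :
    G.TreeCase ∨ G.CycleCase ∨ G.CompleteCase := by
  obtain ⟨c, hc0, hc, h | ⟨h2, A, hA0, hAc, hA⟩⟩ := attach_dichotomy hn hG hinv
  · have ht := isMulTree_of_attach hG hc0 hc h
    refine Or.inl ⟨c, hc0, ht, parkingFunctions_eq_of_dvd hG (fun x y => ?_) hc⟩
    obtain ⟨-, T, -, hT⟩ := ht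
    exact ⟨_, hT x y⟩
  · have hU : G.UniformAttach A (c - A) :=
      ⟨h2, hA0, by omega, hG, fun x hx => by rw [hc x hx]; omega, hA⟩
    rcases hU.complete_or_cycle with ⟨a, ha, rfl⟩ | hAb
    · exact Or.inr (Or.inr ⟨a, c - A, ha, hU.b_pos, rfl, parkingFunctions_completeMul _ _ _⟩)
    · rw [← hAb] at hU
      exact Or.inr (Or.inl ⟨h2, A, hA0, hU.isMulCycle, hU.parkingFunctions_eq⟩)

/-- The parking sets alone already differ: the constant a − 1 forces a ≤ a', and a single entry 2a'
− 1 forces 2a' ≤ a. -/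
theorem not_treeCase_and_cycleCase {G : Multigraph n} : ¬ (G.TreeCase ∧ G.CycleCase) := by
  rintro ⟨⟨a, ha, -, h1⟩, hn, a', ha', -, h2⟩
  have h : ∀ α : Fin n → ℕ, (∀ i, α i < a) ↔
      (∀ i : Fin n, α i < 2 * a') ∧ ∀ i j, i ≠ j → α i < a' ∨ α j < a' := fun α => by
    rw [← mem_vectorParkingFunctions_headVec_zero, ← h1, h2, mem_vectorParkingFunctions_endsVec hn]
  have e1 := ((h fun _ => a - 1).1 (fun _ => by omega)).2 ⟨0, by omega⟩ ⟨1, by omega⟩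
    (by simp [Fin.ext_iff])
  have e2 := (h (Pi.single ⟨0, by omega⟩ (2 * a' - 1))).2 ⟨fun i => ?_, fun i j hij => ?_⟩
    ⟨0, by omega⟩
  · rw [Pi.single_eq_same] at e2
    omega
  · rw [Pi.single_apply]
    split_ifs <;> omega
  · simp only [Pi.single_apply]
    split_ifs with hi hj
    · exact absurd (hi.trans hj.symm) hij
    all_goals omega

theorem not_treeCase_and_completeCase (hn : 2 ≤ n) {G : Multigraph n} :
    ¬ (G.TreeCase ∧ G.CompleteCase) := by
  rintro ⟨⟨a, ha, -, h1⟩, a', b, ha', hb, -, h2⟩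
  have e1 : (fun _ : Fin n => a - 1) ∈ vectorParkingFunctions (headVec n a 0) :=
    mem_vectorParkingFunctions_headVec_zero.2 fun _ => by omega
  rw [← h1, h2] at e1
  have e1 := const_mem_headVec e1 (by omega)
  have e2 := staircase_mem_headVec (n := n) ha' b
  rw [← h2, h1, mem_vectorParkingFunctions_headVec_zero] at e2
  have := e2 ⟨1, hn⟩
  simp only [one_mul] at this
  omega

/-- The constant a − 1 forces a ≤ a'. The second and third staircase entries are then both at least
a, which the cycle vector forbids; the third entry needs n ≥ 3. -/
theorem not_cycleCase_and_completeCase (hn : 3 ≤ n) {G : Multigraph n} :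
    ¬ (G.CycleCase ∧ G.CompleteCase) := by
  rintro ⟨⟨hn', a, ha, -, h1⟩, a', b, ha', hb, -, h2⟩
  have e1 : (fun _ : Fin n => a - 1) ∈ vectorParkingFunctions (endsVec n a) :=
    (mem_vectorParkingFunctions_endsVec hn').2
      ⟨fun _ => by omega, fun _ _ _ => Or.inl (by omega)⟩
  rw [← h1, h2] at e1
  have e1 := const_mem_headVec e1 (by omega)
  have e2 := staircase_mem_headVec (n := n) ha' b
  rw [← h2, h1, mem_vectorParkingFunctions_endsVec hn'] at e2
  have := e2.2 ⟨1, hn'⟩ ⟨2, hn⟩ (by simp [Fin.ext_iff])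
  simp only [one_mul] at this
  omega

end Multigraph

theorem mainTheorem5 (n : ℕ) (hn : 1 ≤ n) (G : Multigraph n) :
    (G.Connected → PermInvariant G.parkingFunctions →
      (G.TreeCase ∨ G.CycleCase ∨ G.CompleteCase) ∧
      (2 ≤ n → ¬ (G.TreeCase ∧ G.CycleCase) ∧ ¬ (G.TreeCase ∧ G.CompleteCase)) ∧
      (3 ≤ n → ¬ (G.CycleCase ∧ G.CompleteCase))) ∧
    (¬ PermInvariant G.parkingFunctions →
      ∀ x : Fin n → ℕ, G.parkingFunctions ≠ vectorParkingFunctions x) := by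
  refine ⟨fun hG hinv => ⟨Multigraph.classification hn hG hinv, fun h2 =>
    ⟨Multigraph.not_treeCase_and_cycleCase, Multigraph.not_treeCase_and_completeCase h2⟩,
    fun h3 => Multigraph.not_cycleCase_and_completeCase h3⟩, fun hinv x hx => hinv ?_⟩
  rw [hx]
  exact permInvariant_vectorParkingFunctions x
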